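/- Let $m,n\ge 1$ be integers with $m+n\ge 3$, and let $K_{m,n}$ be the complete bipartite graph with parts of sizes $m$ and $n$. For a finite connected graph $\Gamma$ let $F_\Gamma=\sum_{T}\prod_{e\in E(T)}x_e$ be its Kirchhoff polynomial, where $T$ runs over the spanning trees of $\Gamma$, let $H_\Gamma=\left(\frac{\partial^2 F_\Gamma}{\partial x_i\,\partial x_j}\right)_{i,j\in E(\Gamma)}$, and let $\tilde H_\Gamma$ be the real symmetric matrix obtained from $H_\Gamma$ by setting all $x_e=1$. Then the eigenvalues of $\tilde H_{K_{m,n}}$ are \[ -2m^{n-2}n^{m-2},\qquad -m^{n-2}n^{m-1},\qquad -m^{n-1}n^{m-2},\qquad m^{n-2}n^{m-2}(m+n-1)(m+n-2), \] with multiplicities \[ (m-1)(n-1),\qquad n-1,\qquad m-1,\qquad 1, \] respectively. Here a value listed with multiplicity $0$ contributes nothing, and when several of the listed values coincide their multiplicities are added. In precise terms, writing $\lambda_1,\dots,\lambda_4$ for the values and $d_1,\dots,d_4$ for the multiplicities, the characteristic polynomial of $\tilde H_{K_{m,n}}$ is $\prod_{k=1}^4(t-\lambda_k)^{d_k}$,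 and for every $\mu\in\mathbb R$ the eigenspace $\ker(\tilde H_{K_{m,n}}-\mu I)$ has dimension $\sum_{k:\lambda_k=\mu}d_k$. In particular, the quadratic form of $\tilde H_{K_{m,n}}$ has Lorentzian signature: its positive index of inertia is $1$ and its negative index of inertia is $mn-1$. -/

import Mathlib

noncomputable section

namespace SpanningTreeHessian

instance decidableRelCompleteBipartiteGraphAdj (V W : Type*) :
    DecidableRel (completeBipartiteGraph V W).Adj := fun v w =>
  inferInstanceAs (Decidable (v.isLeft ∧ w.isRight ∨ v.isRight ∧ w.isLeft))

open scoped Classical in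
/-- The set `B_G` of spanning trees of a graph `G`. A spanning tree is given by its set of edges `T`:
the graph on *all* vertices of `G` whose edges are those in `T` has to be a tree. -/
def spanningTrees {V : Type*} (G : SimpleGraph V) [Fintype G.edgeSet] :
    Finset (Finset G.edgeSet) :=
  Finset.univ.filter fun T =>
    (SimpleGraph.fromEdgeSet ((fun e : G.edgeSet => (e : Sym2 V)) '' (T : Set G.edgeSet))).IsTree

/-- The Kirchhoff polynomial `F_G = ∑_T ∏_{e ∈ T} x_e`, with one variable `x_e` for each edge `e`
of `G`, the sum running over the spanning trees `T` of `G`. -/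
def kirchhoffPolynomial {V : Type*} (G : SimpleGraph V) [Fintype G.edgeSet] :
    MvPolynomial G.edgeSet ℝ :=
  ∑ T ∈ spanningTrees G, ∏ e ∈ T, MvPolynomial.X e

/-- The Hessian matrix `H_G = (∂²F_G / ∂x_i ∂x_j)`, indexed by the edges of `G`. -/
def hessianMatrix {V : Type*} (G : SimpleGraph V) [Fintype G.edgeSet] :
    Matrix G.edgeSet G.edgeSet (MvPolynomial G.edgeSet ℝ) :=
  Matrix.of fun i j =>
    MvPolynomial.pderiv i (MvPolynomial.pderiv j (kirchhoffPolynomial G))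

/-- The real matrix `H̃_G`: the value of the Hessian matrix `H_G` at the point where all the
variables are equal to `1`. -/
def hessianAtOne {V : Type*} (G : SimpleGraph V) [Fintype G.edgeSet] :
    Matrix G.edgeSet G.edgeSet ℝ :=
  (hessianMatrix G).map (MvPolynomial.eval fun _ => (1 : ℝ))

end SpanningTreeHessian

end

/-!
Let `B` be the incidence matrix of an orientation of the graph, `W` the diagonal matrix of the edge
weights and `J` an all-ones matrix. By the Cauchy–Binet formula, `det (B W Bᵀ + J)` is `|V|²` times
the Kirchhoff polynomial. Perturbing two weights around `1` multiplies this determinant by a `2 × 2`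
determinant, so the second partial derivatives of the Kirchhoff polynomial at `1` are the number of
spanning trees times the principal `2 × 2` minors of `Bᵀ (B Bᵀ + J)⁻¹ B`.

For `K_{m,n}` the matrix `B Bᵀ + J` is block diagonal with blocks `n + J` and `m + J`, hence easy to
invert. On edges, regarded as pairs of vertices, the Hessian becomes a linear combination of
`1 ⊗ 1`, `1 ⊗ J`, `J ⊗ 1` and `J ⊗ J`, and products of eigenvectors of the two matrices `J`
diagonalize all four at once.
-/

open Finset Matrix
open scoped Kronecker Polynomial

namespace SpanningTreeHessian

section Determinants

variable {m n R : Type*} [Fintype m] [DecidableEq m] [Fintype n] [DecidableEq n] [CommRing R]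

theorem coeff_det_one_add_X_smul_mul_diagonal_mul_transpose (A : Matrix m n R) (w : n → R)
    (k : ℕ) :
    (1 + (Polynomial.X : R[X]) • (A * diagonal w * Aᵀ).map Polynomial.C).det.coeff k =
      ∑ S ∈ powersetCard k univ,
        (∏ i ∈ S, w i) * ((Aᵀ * A).submatrix ((↑) : S → n) (↑)).det := by
  have hcomm : (1 + (Polynomial.X : R[X]) • (A * diagonal w * Aᵀ).map Polynomial.C).det =
      (1 + (Polynomial.X : R[X]) • (diagonal w * (Aᵀ * A)).map Polynomial.C).det := by
    rw [Matrix.mul_assoc, Matrix.map_mul, ← Matrix.mul_smul, det_one_add_mul_comm,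
      Matrix.smul_mul, ← Matrix.map_mul, Matrix.mul_assoc]
  rw [hcomm, coeff_det_one_add_X_smul_eq_sum_minors]
  refine sum_congr rfl fun S _ => ?_
  have hrows : (diagonal w * (Aᵀ * A)).submatrix ((↑) : S → n) ((↑) : S → n) =
      diagonal (fun i : S => w i) * (Aᵀ * A).submatrix (↑) (↑) := by
    ext i j
    simp only [submatrix_apply, diagonal_mul]
  rw [hrows, det_mul, det_diagonal, prod_coe_sort S w]

theorem det_add_vecMulVec_of_mulVec_eq_zero [IsDomain R] {M : Matrix m m R} {u : m → R}
    (hu : u ≠ 0) (hMu : M *ᵥ u = 0) (v : m → R) :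
    (M + vecMulVec u v).det =
      v ⬝ᵥ u * (1 + (Polynomial.X : R[X]) • M.map Polynomial.C).det.coeff (Fintype.card m - 1) := by
  have hdet : M.det = 0 := exists_mulVec_eq_zero_iff.1 ⟨u, hu, hMu⟩
  obtain ⟨i, -⟩ := Function.ne_iff.1 hu
  have hcard : Fintype.card m - 1 + 1 = Fintype.card m :=
    Nat.sub_add_cancel (Fintype.card_pos_iff.2 ⟨i⟩)
  have hcoeff (N : Matrix m m R) :
      (1 + (Polynomial.X : R[X]) • N.map Polynomial.C).det.coeff (Fintype.card m) = N.det := by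
    rw [coeff_det_one_add_X_smul_eq_sum_minors, ← card_univ, powersetCard_self, sum_singleton]
    exact det_submatrix_equiv_self (Equiv.subtypeUnivEquiv mem_univ) N
  let Q : Matrix m m R[X] := vecMulVec (Polynomial.C ∘ u) (Polynomial.C ∘ v)
  have hfactor : 1 + (Polynomial.X : R[X]) • (M + vecMulVec u v).map Polynomial.C =
      (1 + (Polynomial.X : R[X]) • M.map Polynomial.C) * (1 + (Polynomial.X : R[X]) • Q) := by
    have hzero : M.map Polynomial.C * Q = 0 := by
      rw [mul_vecMulVec]
      ext i j : 2
      rw [vecMulVec_apply, ← RingHom.map_mulVec, hMu]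
      simp
    have hmap : (M + vecMulVec u v).map Polynomial.C = M.map Polynomial.C + Q := by
      ext i j : 2
      simp [Q, vecMulVec_apply]
    simp only [hmap, Matrix.add_mul, Matrix.mul_add, Matrix.one_mul, Matrix.mul_one,
      Matrix.smul_mul, Matrix.mul_smul, hzero, smul_zero, add_zero, smul_add, add_assoc]
  have hrankOne : (1 + (Polynomial.X : R[X]) • Q).det =
      1 + Polynomial.X * Polynomial.C (v ⬝ᵥ u) := by
    rw [← smul_vecMulVec, vecMulVec_eq Unit, det_one_add_replicateCol_mul_replicateRow,
      dotProduct_smul, smul_eq_mul, RingHom.map_dotProduct]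
  rw [← hcoeff, hfactor, det_mul, hrankOne, mul_add, mul_one, Polynomial.coeff_add, hcoeff, hdet,
    zero_add, ← mul_assoc, Polynomial.coeff_mul_C, ← hcard, Polynomial.coeff_mul_X,
    Nat.add_sub_cancel, mul_comm]

/-- When the columns of `B` sum to zero, `B` is recovered from any of its maximal minors, which are
therefore all equal up to sign. -/
theorem det_transpose_mul_self_of_one_vecMul_eq_zero {r : m} (B : Matrix m {v // v ≠ r} R)
    (hB : 1 ᵥ* B = 0) :
    (Bᵀ * B).det = Fintype.card m * (B.submatrix (↑) id).det ^ 2 := by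
  set A : Matrix {v // v ≠ r} {v // v ≠ r} R := B.submatrix (↑) id
  have hrow : ∀ w, B r w = -∑ v, A v w := fun w => by
    have := congrFun hB w
    simp only [vecMul, dotProduct, Pi.one_apply, one_mul, Pi.zero_apply] at this
    rw [Fintype.sum_eq_add_sum_subtype_ne _ r] at this
    exact eq_neg_of_add_eq_zero_left this
  have hgram : Bᵀ * B = Aᵀ * (1 + vecMulVec 1 1) * A := by
    ext w w'
    rw [Matrix.mul_add, Matrix.mul_one, Matrix.add_mul, mul_vecMulVec, vecMulVec_mul, mul_apply,
      Fintype.sum_eq_add_sum_subtype_ne _ r, Matrix.add_apply, add_comm]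
    simp [A, mul_apply, vecMulVec_apply, mulVec, vecMul, dotProduct, hrow]
  have hcard : Fintype.card m = Fintype.card {v // v ≠ r} + 1 := by
    have : 0 < Fintype.card m := Fintype.card_pos_iff.2 ⟨r⟩
    simpa using (Nat.sub_add_cancel this).symm
  rw [hgram, det_mul, det_mul, det_transpose, vecMulVec_eq Unit,
    det_one_add_replicateCol_mul_replicateRow, one_dotProduct_one, hcard, Nat.cast_add_one]
  ring

end Determinants

section MatrixTree

/-- The matrix all of whose entries are `1`. -/
def allOnes (n R : Type*) [One R] : Matrix n n R :=
  of fun _ _ => 1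

@[simp]
theorem allOnes_apply {n R : Type*} [One R] (i j : n) : allOnes n R i j = 1 :=
  rfl

theorem vecMulVec_one_one {n R : Type*} [MulOneClass R] :
    vecMulVec 1 1 = allOnes n R := by
  ext i j
  rw [vecMulVec_apply, Pi.one_apply, Pi.one_apply, mul_one, allOnes_apply]

variable {V : Type*} {G : SimpleGraph V}

/-- An orientation of the edges of `G`: a choice, for each edge, of one of its two darts. The signs
in the incidence matrix depend on it, the Laplacian does not. -/
structure EdgeOrientation (G : SimpleGraph V) where
  dart : G.edgeSet → G.Dart
  edge_dart : ∀ e, (dart e).edge = e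

/-- The signed incidence matrix of an oriented graph, with entries `1` at the first and `-1` at the
second vertex of each edge. -/
def EdgeOrientation.incidence [DecidableEq V] (o : EdgeOrientation G) (R : Type*) [Ring R] :
    Matrix V G.edgeSet R :=
  of fun v e => (Pi.single (o.dart e).fst 1 : V → R) v - (Pi.single (o.dart e).snd 1 : V → R) v

/-- The spanning subgraph of `G` whose edges are those in `S`. -/
def spanningSubgraph (S : Set G.edgeSet) : SimpleGraph V :=
  SimpleGraph.fromEdgeSet ((↑) '' S)

theorem mem_spanningTrees_iff_isTree [Fintype G.edgeSet] {T : Finset G.edgeSet} :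
    T ∈ spanningTrees G ↔ (spanningSubgraph (T : Set G.edgeSet)).IsTree := by
  simp [spanningTrees, spanningSubgraph]

theorem edgeSet_spanningSubgraph (S : Set G.edgeSet) :
    (spanningSubgraph S).edgeSet = (↑) '' S := by
  rw [spanningSubgraph, SimpleGraph.edgeSet_fromEdgeSet, sdiff_eq_left, Set.disjoint_left]
  rintro _ ⟨e, -, rfl⟩
  exact G.not_isDiag_of_mem_edgeSet e.2

theorem mem_spanningTrees_iff_connected_and_card [Fintype V] [Fintype G.edgeSet]
    {T : Finset G.edgeSet} : T ∈ spanningTrees G ↔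
      (spanningSubgraph (T : Set G.edgeSet)).Connected ∧ #T + 1 = Fintype.card V := by
  rw [mem_spanningTrees_iff_isTree, SimpleGraph.isTree_iff_connected_and_card,
    edgeSet_spanningSubgraph, Nat.card_coe_set_eq,
    Set.ncard_image_of_injective _ Subtype.val_injective, Set.ncard_coe_finset,
    Nat.card_eq_fintype_card]

namespace EdgeOrientation

variable (o : EdgeOrientation G)

theorem sym2_dart (e : G.edgeSet) : s((o.dart e).fst, (o.dart e).snd) = (e : Sym2 V) :=
  o.edge_dart e

theorem spanningSubgraph_adj_dart {S : Set G.edgeSet} {e : G.edgeSet} (he : e ∈ S) :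
    (spanningSubgraph S).Adj (o.dart e).fst (o.dart e).snd := by
  rw [← SimpleGraph.mem_edgeSet, edgeSet_spanningSubgraph]
  exact ⟨e, he, (o.edge_dart e).symm⟩

variable [DecidableEq V]

theorem map_incidence {R S : Type*} [Ring R] [Ring S] (f : R →+* S) :
    (o.incidence R).map f = o.incidence S := by
  ext v e
  simp [incidence, Pi.single_apply, apply_ite f]

variable {R : Type*} [Ring R]

theorem vecMul_incidence [Fintype V] (x : V → R) :
    x ᵥ* o.incidence R = fun e => x (o.dart e).fst - x (o.dart e).snd := by
  ext e
  simp [incidence, vecMul, dotProduct, mul_sub, Pi.single_apply]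

theorem one_vecMul_incidence [Fintype V] : 1 ᵥ* o.incidence R = 0 := by
  rw [vecMul_incidence]
  exact funext fun _ => sub_self _

variable [Fintype V] {r : V} {f : {v // v ≠ r} → G.edgeSet}

theorem isUnit_det_incidence_of_connected
    (hconn : (spanningSubgraph (Set.range f)).Connected) :
    IsUnit ((o.incidence ℤ).submatrix ((↑) : {v // v ≠ r} → V) f).det := by
  set A := (o.incidence ℤ).submatrix ((↑) : {v // v ≠ r} → V) f
  let δ (x : V) : {v // v ≠ r} → ℤ := fun v => (Pi.single x 1 : V → ℤ) v
  have hdart (w) : δ (o.dart (f w)).fst - δ (o.dart (f w)).snd ∈ LinearMap.range A.mulVecLin :=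
    ⟨Pi.single w 1, by ext; simp [A, δ, incidence]⟩
  have hadj {u v} (huv : (spanningSubgraph (Set.range f)).Adj u v) :
      δ u - δ v ∈ LinearMap.range A.mulVecLin := by
    rw [← SimpleGraph.mem_edgeSet, edgeSet_spanningSubgraph] at huv
    obtain ⟨_, ⟨w, rfl⟩, hw⟩ := huv
    rcases Sym2.eq_iff.1 ((o.sym2_dart _).trans hw) with ⟨rfl, rfl⟩ | ⟨rfl, rfl⟩
    · exact hdart w
    · simpa using Submodule.neg_mem _ (hdart w)
  have hreach {u v} (huv : (spanningSubgraph (Set.range f)).Reachable u v) :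
      δ u - δ v ∈ LinearMap.range A.mulVecLin := by
    obtain ⟨p⟩ := huv
    induction p with
    | nil => simp
    | cons h _ ih => simpa using Submodule.add_mem _ (hadj h) ih
  have hroot : δ r = 0 := by
    ext v
    simp [δ, v.2]
  have hbasis (v : {v // v ≠ r}) : Pi.basisFun ℤ _ v ∈ LinearMap.range A.mulVecLin := by
    have hδ : Pi.basisFun ℤ _ v = δ v := by
      ext
      simp [δ, Pi.single_apply, Subtype.ext_iff]
    simpa [hroot, hδ] using hreach (hconn.preconnected v r)
  rw [← isUnit_iff_isUnit_det, ← mulVec_surjective_iff_isUnit]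
  suffices hrange : LinearMap.range A.mulVecLin = ⊤ from LinearMap.range_eq_top.1 hrange
  rw [eq_top_iff, ← (Pi.basisFun ℤ _).span_eq, Submodule.span_le, Set.range_subset_iff]
  exact hbasis

theorem det_incidence_eq_zero_of_not_connected
    (hconn : ¬ (spanningSubgraph (Set.range f)).Connected) :
    ((o.incidence ℤ).submatrix ((↑) : {v // v ≠ r} → V) f).det = 0 := by
  classical
  obtain ⟨v, hv⟩ : ∃ v, ¬ (spanningSubgraph (Set.range f)).Reachable v r := by
    by_contra! h
    have : Nonempty V := ⟨r⟩
    exact hconn ⟨fun u v => (h u).trans (h v).symm⟩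
  let x : V → ℤ := fun u => if (spanningSubgraph (Set.range f)).Reachable v u then 1 else 0
  have hxr : x r = 0 := if_neg hv
  rw [← exists_vecMul_eq_zero_iff]
  refine ⟨fun u => x u, fun h => ?_, funext fun w => ?_⟩
  · have hvr : v ≠ r := ne_of_apply_ne x (by simp [hxr, x])
    simpa [x] using congrFun h ⟨v, hvr⟩
  · have hadj := (o.spanningSubgraph_adj_dart (Set.mem_range_self (f := f) w)).reachable
    have hx : x (o.dart (f w)).fst = x (o.dart (f w)).snd :=
      if_congr ⟨fun h => h.trans hadj, fun h => h.trans hadj.symm⟩ rfl rfl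
    calc ∑ u : {v // v ≠ r}, x u * o.incidence ℤ u (f w)
      _ = (x ᵥ* o.incidence ℤ) (f w) := by
        rw [vecMul, dotProduct, Fintype.sum_eq_add_sum_subtype_ne _ r, hxr, zero_mul, zero_add]
      _ = 0 := (congrFun (o.vecMul_incidence x) (f w)).trans (sub_eq_zero.2 hx)

end EdgeOrientation

namespace EdgeOrientation

variable [Fintype V] [DecidableEq V] [Fintype G.edgeSet] (o : EdgeOrientation G) {R : Type*}
  [CommRing R]

theorem det_gram_incidence {S : Finset G.edgeSet} (hS : #S + 1 = Fintype.card V) :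
    (((o.incidence R)ᵀ * o.incidence R).submatrix ((↑) : S → G.edgeSet) (↑)).det =
      if S ∈ spanningTrees G then (Fintype.card V : R) else 0 := by
  obtain ⟨r⟩ : Nonempty V := Fintype.card_pos_iff.1 (by lia)
  have hcard : Fintype.card {v // v ≠ r} = Fintype.card S := by simp [← hS]
  let σ := Fintype.equivOfCardEq hcard
  let f : {v // v ≠ r} → G.edgeSet := fun v => σ v
  have hrange : Set.range f = S := by
    rw [Set.range_comp' Subtype.val σ, σ.range_eq_univ, Set.image_univ, Subtype.range_coe]
  have hzero : 1 ᵥ* (o.incidence R).submatrix id f = 0 :=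
    funext fun v => congrFun o.one_vecMul_incidence (f v)
  have hcast : (((o.incidence R).submatrix id f).submatrix ((↑) : {v // v ≠ r} → V) id).det =
      (((o.incidence ℤ).submatrix ((↑) : {v // v ≠ r} → V) f).det : R) := by
    rw [Int.cast_det, ← o.map_incidence (Int.castRingHom R)]
    rfl
  have hsubmatrix : (((o.incidence R)ᵀ * o.incidence R).submatrix (↑) (↑)).submatrix σ σ =
      ((o.incidence R).submatrix id f)ᵀ * (o.incidence R).submatrix id f := rfl
  rw [← det_submatrix_equiv_self σ, hsubmatrix,
    det_transpose_mul_self_of_one_vecMul_eq_zero _ hzero, hcast]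
  have htree := mem_spanningTrees_iff_connected_and_card (T := S)
  rw [← hrange] at htree
  split_ifs with hmem
  · rcases Int.isUnit_iff.1 (o.isUnit_det_incidence_of_connected (htree.1 hmem).1) with h | h <;>
      simp [h]
  · rw [o.det_incidence_eq_zero_of_not_connected fun hconn => hmem (htree.2 ⟨hconn, hS⟩)]
    simp

/-- The Laplacian of `G` with edge weights `w`, plus the all-ones matrix. The added matrix fills in
the kernel of the Laplacian, which would otherwise have to be removed by deleting a vertex. -/
def augmentedLaplacian (w : G.edgeSet → R) : Matrix V V R :=
  o.incidence R * diagonal w * (o.incidence R)ᵀ + allOnes V R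

theorem det_augmentedLaplacian [IsDomain R] [Nonempty V] (w : G.edgeSet → R) :
    (o.augmentedLaplacian w).det =
      Fintype.card V ^ 2 * ∑ T ∈ spanningTrees G, ∏ e ∈ T, w e := by
  have hker : (o.incidence R * diagonal w * (o.incidence R)ᵀ) *ᵥ 1 = 0 := by
    rw [← mulVec_mulVec, mulVec_transpose, one_vecMul_incidence, mulVec_zero]
  have htrees : spanningTrees G ⊆ powersetCard (Fintype.card V - 1) univ := fun T hT => by
    have := (mem_spanningTrees_iff_connected_and_card.1 hT).2
    exact mem_powersetCard.2 ⟨subset_univ T, by lia⟩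
  have hgram {S : Finset G.edgeSet} (hS : S ∈ powersetCard (Fintype.card V - 1) univ) :
      (((o.incidence R)ᵀ * o.incidence R).submatrix ((↑) : S → G.edgeSet) (↑)).det =
        if S ∈ spanningTrees G then (Fintype.card V : R) else 0 := by
    have := Fintype.card_pos (α := V)
    exact o.det_gram_incidence (by rw [(mem_powersetCard.1 hS).2]; lia)
  calc _ = Fintype.card V * ∑ S ∈ powersetCard (Fintype.card V - 1) univ,
        if S ∈ spanningTrees G then (∏ e ∈ S, w e) * Fintype.card V else 0 := by
        rw [augmentedLaplacian, ← vecMulVec_one_one,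
          det_add_vecMulVec_of_mulVec_eq_zero one_ne_zero hker,
          coeff_det_one_add_X_smul_mul_diagonal_mul_transpose, one_dotProduct_one]
        congr 1
        refine sum_congr rfl fun S hS => ?_
        rw [hgram hS, mul_ite, mul_zero]
    _ = _ := by
        rw [sum_ite_mem, inter_eq_right.2 htrees, ← sum_mul]
        ring

end EdgeOrientation

end MatrixTree

section Hessian

theorem eval_one_pderiv_pderiv_prod_X {σ R : Type*} [DecidableEq σ] [CommSemiring R]
    (T : Finset σ) (i j : σ) :
    MvPolynomial.eval (fun _ => (1 : R)) (MvPolynomial.pderiv i (MvPolynomial.pderiv j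
      (∏ e ∈ T, MvPolynomial.X e))) = if i ≠ j ∧ i ∈ T ∧ j ∈ T then 1 else 0 := by
  have hmonomial : (∏ e ∈ T, MvPolynomial.X e : MvPolynomial σ R) =
      MvPolynomial.monomial (∑ e ∈ T, Finsupp.single e 1) 1 := by
    simp [MvPolynomial.X, MvPolynomial.monomial_sum_one]
  have hexponent (x) : (∑ e ∈ T, Finsupp.single e 1 : σ →₀ ℕ) x = if x ∈ T then 1 else 0 := by
    simp [Finsupp.finsetSum_apply, Finsupp.single_apply]
  rw [hmonomial, MvPolynomial.pderiv_monomial, MvPolynomial.pderiv_monomial,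
    MvPolynomial.eval_monomial]
  simp only [Finsupp.tsub_apply, hexponent, Finsupp.single_apply]
  obtain rfl | hij := eq_or_ne i j
  · by_cases hi : i ∈ T <;> simp [hi]
  · by_cases hi : i ∈ T <;> by_cases hj : j ∈ T <;> simp [hi, hj, hij, hij.symm]

theorem det_one_add_mul_diagonal_fin_two {R : Type*} [CommRing R] (P : Matrix (Fin 2) (Fin 2) R)
    (s t : R) :
    (1 + P * diagonal ![s, t]).det = 1 + s * P 0 0 + t * P 1 1 + s * t * P.det := by
  simp only [det_fin_two, Matrix.add_apply, mul_diagonal, cons_val_zero, cons_val_one, one_apply_eq,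
    one_apply_ne (zero_ne_one (α := Fin 2)), one_apply_ne (one_ne_zero (α := Fin 2))]
  ring

theorem prod_one_add_single_add_single {σ R : Type*} [DecidableEq σ] [CommSemiring R]
    (T : Finset σ) {i j : σ} (hij : i ≠ j) (s t : R) :
    ∏ e ∈ T, (1 + Pi.single i s + Pi.single j t : σ → R) e =
      (1 + if i ∈ T then s else 0) * (1 + if j ∈ T then t else 0) := by
  have hfactor (e : σ) : (1 + Pi.single i s + Pi.single j t : σ → R) e =
      (if e = i then 1 + s else 1) * (if e = j then 1 + t else 1) := by
    obtain rfl | hi := eq_or_ne e i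
    · simp [hij]
    · obtain rfl | hj := eq_or_ne e j <;> simp [*]
  simp only [hfactor, prod_mul_distrib, prod_ite_eq', add_ite, add_zero]

variable {V : Type*} {G : SimpleGraph V} [Fintype G.edgeSet]

theorem hessianAtOne_apply [DecidableEq G.edgeSet] (i j : G.edgeSet) :
    hessianAtOne G i j = ∑ T ∈ spanningTrees G, if i ≠ j ∧ i ∈ T ∧ j ∈ T then 1 else 0 := by
  simp only [hessianAtOne, hessianMatrix, kirchhoffPolynomial, Matrix.map_apply, Matrix.of_apply,
    map_sum, eval_one_pderiv_pderiv_prod_X]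

namespace EdgeOrientation

variable [Fintype V] [DecidableEq V] (o : EdgeOrientation G)

/-- The transfer current matrix of `G`: its `(i, j)` entry is the current through `j` when a unit
current enters and leaves `G` at the two ends of `i`. The columns of the incidence matrix have sum
zero, and on such vectors the augmented Laplacian agrees with the Laplacian. -/
noncomputable def transferCurrent : Matrix G.edgeSet G.edgeSet ℝ :=
  (o.incidence ℝ)ᵀ * (o.augmentedLaplacian (1 : G.edgeSet → ℝ))⁻¹ * o.incidence ℝ

theorem transferCurrent_apply (i j : G.edgeSet) :
    o.transferCurrent i j =
      let N := (o.augmentedLaplacian (1 : G.edgeSet → ℝ))⁻¹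
      N (o.dart i).fst (o.dart j).fst - N (o.dart i).snd (o.dart j).fst -
        (N (o.dart i).fst (o.dart j).snd - N (o.dart i).snd (o.dart j).snd) := by
  have hmul (M : Matrix G.edgeSet V ℝ) :
      (M * o.incidence ℝ) i j = M i (o.dart j).fst - M i (o.dart j).snd :=
    congrFun (o.vecMul_incidence (M i)) j
  have htranspose (N : Matrix V V ℝ) (v : V) :
      ((o.incidence ℝ)ᵀ * N) i v = N (o.dart i).fst v - N (o.dart i).snd v := by
    rw [← transpose_transpose N, ← transpose_mul, transpose_apply]
    exact congrFun (o.vecMul_incidence (Nᵀ v)) i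
  rw [transferCurrent, hmul, htranspose, htranspose]

theorem det_augmentedLaplacian_one_add_single_add_single {i j : G.edgeSet} (s t : ℝ)
    (hunit : IsUnit (o.augmentedLaplacian (1 : G.edgeSet → ℝ)).det) :
    (o.augmentedLaplacian (1 + Pi.single i s + Pi.single j t)).det =
      (o.augmentedLaplacian 1).det *
        (1 + o.transferCurrent.submatrix ![i, j] ![i, j] * diagonal ![s, t]).det := by
  set U := (o.incidence ℝ).submatrix id ![i, j]
  have hsplit : o.augmentedLaplacian (1 + Pi.single i s + Pi.single j t) =
      o.augmentedLaplacian 1 + U * diagonal ![s, t] * Uᵀ := by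
    rw [augmentedLaplacian, augmentedLaplacian, add_right_comm _ (allOnes V ℝ), add_left_inj]
    ext u v
    simp only [Matrix.add_apply, mul_apply (N := _ᵀ), mul_diagonal, transpose_apply, U,
      submatrix_apply, id, Fin.sum_univ_two]
    simp [mul_add, add_mul, sum_add_distrib, Pi.single_apply, add_assoc]
  have hK : o.transferCurrent.submatrix ![i, j] ![i, j] =
      Uᵀ * (o.augmentedLaplacian (1 : G.edgeSet → ℝ))⁻¹ * U :=
    rfl
  rw [hsplit, Matrix.mul_assoc U, det_add_mul _ _ hunit, hK,
    det_one_add_mul_comm _ (diagonal ![s, t]), ← Matrix.mul_assoc, ← Matrix.mul_assoc]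

theorem hessianAtOne_eq_card_mul_det_transferCurrent (i j : G.edgeSet) :
    hessianAtOne G i j =
      #(spanningTrees G) * (o.transferCurrent.submatrix ![i, j] ![i, j]).det := by
  rw [hessianAtOne_apply]
  obtain rfl | hij := eq_or_ne i j
  · rw [det_fin_two]
    simp
  obtain htrees | htrees := (spanningTrees G).eq_empty_or_nonempty
  · simp [htrees]
  have : Nonempty V := ⟨(o.dart i).fst⟩
  have hdet : (o.augmentedLaplacian (1 : G.edgeSet → ℝ)).det =
      Fintype.card V ^ 2 * #(spanningTrees G) := by
    simpa using o.det_augmentedLaplacian (1 : G.edgeSet → ℝ)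
  have hunit : IsUnit (o.augmentedLaplacian (1 : G.edgeSet → ℝ)).det := by
    rw [hdet, isUnit_iff_ne_zero]
    have := htrees.card_ne_zero
    positivity
  have hsum (s t : ℝ) :
      ∑ T ∈ spanningTrees G, (1 + if i ∈ T then s else 0) * (1 + if j ∈ T then t else 0) =
        #(spanningTrees G) *
          (1 + o.transferCurrent.submatrix ![i, j] ![i, j] * diagonal ![s, t]).det := by
    have h := o.det_augmentedLaplacian_one_add_single_add_single (i := i) (j := j) s t hunit
    rw [o.det_augmentedLaplacian, hdet, mul_assoc] at h
    simpa only [prod_one_add_single_add_single _ hij] using mul_left_cancel₀ (by positivity) h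
  calc _ = ∑ T ∈ spanningTrees G, (1 + if i ∈ T then 1 else 0) * (1 + if j ∈ T then 1 else 0) -
      ∑ T ∈ spanningTrees G, (1 + if i ∈ T then 1 else 0) * (1 + if j ∈ T then 0 else 0) -
      ∑ T ∈ spanningTrees G, (1 + if i ∈ T then 0 else 0) * (1 + if j ∈ T then 1 else 0) +
      ∑ T ∈ spanningTrees G, ((1 + if i ∈ T then 0 else 0) * (1 + if j ∈ T then 0 else 0) : ℝ) := by
        rw [← sum_sub_distrib, ← sum_sub_distrib, ← sum_add_distrib]
        refine sum_congr rfl fun T _ => ?_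
        by_cases hi : i ∈ T <;> by_cases hj : j ∈ T <;> norm_num [hi, hj, hij]
    _ = _ := by
        simp only [hsum, det_one_add_mul_diagonal_fin_two]
        ring

end EdgeOrientation

end Hessian

section CompleteBipartite

theorem det_smul_one_add_allOnes {n K : Type*} [Fintype n] [DecidableEq n] [Nonempty n] [Field K]
    {c : K} (hc : c ≠ 0) :
    (c • 1 + allOnes n K).det = c ^ (Fintype.card n - 1) * (c + Fintype.card n) := by
  have hsmul : c • 1 + allOnes n K = c • (1 + vecMulVec (c⁻¹ • 1) 1) := by
    rw [smul_vecMulVec, smul_add, smul_inv_smul₀ hc, vecMulVec_one_one]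
  rw [hsmul, det_smul, vecMulVec_eq Unit, det_one_add_replicateCol_mul_replicateRow,
    dotProduct_smul, one_dotProduct_one, ← mul_pow_sub_one Fintype.card_ne_zero, smul_eq_mul,
    mul_comm c, mul_assoc, mul_add, mul_one, mul_inv_cancel_left₀ hc]

theorem inv_smul_one_add_allOnes {n K : Type*} [Fintype n] [DecidableEq n] [Field K] {c : K}
    (hc : c ≠ 0) (hcard : c + Fintype.card n ≠ 0) :
    (c • 1 + allOnes n K)⁻¹ = c⁻¹ • 1 - (c * (c + Fintype.card n))⁻¹ • allOnes n K := by
  have hsq : allOnes n K * allOnes n K = (Fintype.card n : K) • allOnes n K := by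
    ext i j
    simp [mul_apply]
  refine inv_eq_right_inv ?_
  simp only [Matrix.mul_sub, Matrix.add_mul, Matrix.mul_smul, Matrix.smul_mul, Matrix.one_mul,
    Matrix.mul_one, hsq]
  match_scalars <;> field_simp
  ring

variable (α β : Type*)

/-- The edges of the complete bipartite graph as pairs of a left and a right vertex. -/
noncomputable def completeBipartiteEdgeEquiv : α × β ≃ (completeBipartiteGraph α β).edgeSet :=
  (Equiv.ofInjective (fun p : α × β => s(Sum.inl p.1, Sum.inr p.2)) fun p q h => by
    simpa [Prod.ext_iff] using h).trans
      (Equiv.setCongr SimpleGraph.edgeSet_completeBipartiteGraph.symm)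

/-- The orientation of the complete bipartite graph from left to right. -/
noncomputable def completeBipartiteOrientation : EdgeOrientation (completeBipartiteGraph α β) where
  dart e := ⟨(.inl ((completeBipartiteEdgeEquiv α β).symm e).1,
    .inr ((completeBipartiteEdgeEquiv α β).symm e).2), by simp⟩
  edge_dart e := congrArg Subtype.val ((completeBipartiteEdgeEquiv α β).apply_symm_apply e)

variable {α β} [Fintype α] [Fintype β] [Fintype (completeBipartiteGraph α β).edgeSet]

theorem augmentedLaplacian_completeBipartiteOrientation [DecidableEq α] [DecidableEq β] {R : Type*}
    [CommRing R] :
    (completeBipartiteOrientation α β).augmentedLaplacian 1 =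
      fromBlocks ((Fintype.card β : R) • 1 + allOnes α R) 0 0
        ((Fintype.card α : R) • 1 + allOnes β R) := by
  ext u v
  rw [EdgeOrientation.augmentedLaplacian, Pi.one_def, diagonal_one, Matrix.mul_one,
    Matrix.add_apply, mul_apply, ← (completeBipartiteEdgeEquiv α β).sum_comp,
    Fintype.sum_prod_type]
  simp only [EdgeOrientation.incidence, completeBipartiteOrientation, transpose_apply, of_apply,
    Equiv.symm_apply_apply]
  rcases u with a | b <;> rcases v with a' | b' <;>
    simp [Pi.single_apply, Matrix.one_apply, eq_comm]

variable [Nonempty α] [Nonempty β]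

theorem card_spanningTrees_completeBipartiteGraph :
    #(spanningTrees (completeBipartiteGraph α β)) =
      Fintype.card α ^ (Fintype.card β - 1) * Fintype.card β ^ (Fintype.card α - 1) := by
  classical
  have hα : (Fintype.card α : ℝ) ≠ 0 := Nat.cast_ne_zero.2 Fintype.card_ne_zero
  have hβ : (Fintype.card β : ℝ) ≠ 0 := Nat.cast_ne_zero.2 Fintype.card_ne_zero
  have htree := (completeBipartiteOrientation α β).det_augmentedLaplacian
    (1 : (completeBipartiteGraph α β).edgeSet → ℝ)
  rw [augmentedLaplacian_completeBipartiteOrientation, det_fromBlocks_zero₂₁,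
    det_smul_one_add_allOnes hα, det_smul_one_add_allOnes hβ] at htree
  simp only [Pi.one_apply, prod_const_one, sum_const, nsmul_one, Fintype.card_sum,
    Nat.cast_add] at htree
  have hne : ((Fintype.card α : ℝ) + Fintype.card β) ^ 2 ≠ 0 := by positivity
  have hcast : (#(spanningTrees (completeBipartiteGraph α β)) : ℝ) =
      Fintype.card α ^ (Fintype.card β - 1) * Fintype.card β ^ (Fintype.card α - 1) :=
    mul_left_cancel₀ hne (by rw [← htree]; ring)
  exact_mod_cast hcast

variable [DecidableEq α] [DecidableEq β]

theorem transferCurrent_completeBipartiteOrientation (p q : α × β) :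
    (completeBipartiteOrientation α β).transferCurrent (completeBipartiteEdgeEquiv α β p)
        (completeBipartiteEdgeEquiv α β q) =
      (1 : Matrix α α ℝ) p.1 q.1 / Fintype.card β + (1 : Matrix β β ℝ) p.2 q.2 / Fintype.card α -
        1 / (Fintype.card α * Fintype.card β) := by
  have hα : (0 : ℝ) < Fintype.card α := Nat.cast_pos.2 Fintype.card_pos
  have hβ : (0 : ℝ) < Fintype.card β := Nat.cast_pos.2 Fintype.card_pos
  have hinv : ((completeBipartiteOrientation α β).augmentedLaplacian
      (1 : (completeBipartiteGraph α β).edgeSet → ℝ))⁻¹ =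
        fromBlocks ((Fintype.card β : ℝ) • 1 + allOnes α ℝ)⁻¹ 0 0
          ((Fintype.card α : ℝ) • 1 + allOnes β ℝ)⁻¹ := by
    rw [augmentedLaplacian_completeBipartiteOrientation]
    refine inv_eq_right_inv ?_
    rw [fromBlocks_multiply, mul_nonsing_inv, mul_nonsing_inv]
    · simp
    all_goals
      rw [det_smul_one_add_allOnes (by positivity), isUnit_iff_ne_zero]
      positivity
  rw [EdgeOrientation.transferCurrent_apply, hinv, inv_smul_one_add_allOnes hβ.ne' (by positivity),
    inv_smul_one_add_allOnes hα.ne' (by positivity)]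
  simp only [completeBipartiteOrientation, Equiv.symm_apply_apply, fromBlocks_apply₁₁,
    fromBlocks_apply₁₂, fromBlocks_apply₂₁, fromBlocks_apply₂₂, Matrix.sub_apply, Matrix.smul_apply,
    Matrix.zero_apply, allOnes_apply, smul_eq_mul, mul_one, _root_.mul_inv_rev, sub_zero, zero_sub,
    neg_sub, one_div]
  field_simp
  ring

theorem submatrix_hessianAtOne_completeBipartiteGraph :
    (hessianAtOne (completeBipartiteGraph α β)).submatrix
        (completeBipartiteEdgeEquiv α β) (completeBipartiteEdgeEquiv α β) =
      ((Fintype.card α : ℝ) ^ ((Fintype.card β : ℤ) - 3) *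
        (Fintype.card β : ℝ) ^ ((Fintype.card α : ℤ) - 3)) •
      ((-2 * Fintype.card α * Fintype.card β : ℝ) • 1 +
        (-Fintype.card α * (Fintype.card α - 2) : ℝ) • (1 ⊗ₖ allOnes β ℝ) +
        (-Fintype.card β * (Fintype.card β - 2) : ℝ) • (allOnes α ℝ ⊗ₖ 1) +
        ((Fintype.card α + Fintype.card β) * (Fintype.card α + Fintype.card β - 2) : ℝ) •
          (allOnes α ℝ ⊗ₖ allOnes β ℝ)) := by
  have hα : (0 : ℝ) < Fintype.card α := Nat.cast_pos.2 Fintype.card_pos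
  have hβ : (0 : ℝ) < Fintype.card β := Nat.cast_pos.2 Fintype.card_pos
  ext p q
  rw [submatrix_apply,
    (completeBipartiteOrientation α β).hessianAtOne_eq_card_mul_det_transferCurrent,
    card_spanningTrees_completeBipartiteGraph, det_fin_two]
  simp only [submatrix_apply, cons_val_zero, cons_val_one,
    transferCurrent_completeBipartiteOrientation]
  have hzpow {x : ℝ} (hx : 0 < x) {k : ℕ} (hk : 0 < k) :
      x ^ ((k : ℤ) - 3) = x ^ (k - 1) / x ^ 2 := by
    rw [← zpow_natCast, ← zpow_natCast, ← zpow_sub₀ hx.ne']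
    congr 1
    lia
  rw [hzpow hα Fintype.card_pos, hzpow hβ Fintype.card_pos]
  obtain ⟨a, b⟩ := p
  obtain ⟨a', b'⟩ := q
  obtain rfl | ha := eq_or_ne a a' <;> obtain rfl | hb := eq_or_ne b b' <;>
    simp [*, Ne.symm] <;> field_simp <;> ring

end CompleteBipartite

section OrthonormalEigenbasis

/-- The columns of `U` form an orthonormal basis of eigenvectors of `H`, the `i`-th one for the
eigenvalue `d i`. -/
structure IsOrthonormalEigenbasis {ι R : Type*} [Fintype ι] [DecidableEq ι] [CommRing R]
    (U H : Matrix ι ι R) (d : ι → R) : Prop where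
  mul_transpose_self : U * Uᵀ = 1
  eq_mul_diagonal_mul_transpose : H = U * diagonal d * Uᵀ

namespace IsOrthonormalEigenbasis

variable {ι ι' R K : Type*} [Fintype ι] [DecidableEq ι] [Fintype ι'] [DecidableEq ι'] [CommRing R]
  [Field K]

section Constructions

variable {U H H' : Matrix ι ι R} {d d' : ι → R} {V A : Matrix ι' ι' R} {a : ι' → R}

theorem one (hU : U * Uᵀ = 1) : IsOrthonormalEigenbasis U 1 1 :=
  ⟨hU, by rw [Pi.one_def, diagonal_one, Matrix.mul_one, hU]⟩

theorem add (hH : IsOrthonormalEigenbasis U H d) (hH' : IsOrthonormalEigenbasis U H' d') :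
    IsOrthonormalEigenbasis U (H + H') (d + d') :=
  ⟨hH.1, by rw [Pi.add_def, ← diagonal_add, Matrix.mul_add, Matrix.add_mul, ← hH.2, ← hH'.2]⟩

theorem smul (c : R) (hH : IsOrthonormalEigenbasis U H d) :
    IsOrthonormalEigenbasis U (c • H) (c • d) :=
  ⟨hH.1, by rw [diagonal_smul, Matrix.mul_smul, Matrix.smul_mul, ← hH.2]⟩

theorem kronecker (hH : IsOrthonormalEigenbasis U H d) (hA : IsOrthonormalEigenbasis V A a) :
    IsOrthonormalEigenbasis (U ⊗ₖ V) (H ⊗ₖ A) fun p => d p.1 * a p.2 where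
  mul_transpose_self := by
    rw [← kroneckerMap_transpose, ← mul_kronecker_mul, hH.1, hA.1, one_kronecker_one]
  eq_mul_diagonal_mul_transpose := by
    rw [← kroneckerMap_transpose, ← diagonal_kronecker_diagonal, ← mul_kronecker_mul,
      ← mul_kronecker_mul, ← hH.2, ← hA.2]

theorem kronecker_combination (hH : IsOrthonormalEigenbasis U H d)
    (hA : IsOrthonormalEigenbasis V A a) (c₀ c₁ c₂ c₃ : R) :
    IsOrthonormalEigenbasis (U ⊗ₖ V)
      (c₀ • 1 + c₁ • (1 ⊗ₖ A) + c₂ • (H ⊗ₖ 1) + c₃ • (H ⊗ₖ A))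
      fun p => c₀ + c₁ * a p.2 + c₂ * d p.1 + c₃ * (d p.1 * a p.2) := by
  have hU := one hH.mul_transpose_self
  have hV := one hA.mul_transpose_self
  have := ((((hU.kronecker hV).smul c₀).add ((hU.kronecker hA).smul c₁)).add
    ((hH.kronecker hV).smul c₂)).add ((hH.kronecker hA).smul c₃)
  rw [one_kronecker_one] at this
  convert this using 2 with p
  simp

theorem submatrix_equiv (hH : IsOrthonormalEigenbasis U H d) (e : ι' ≃ ι) :
    IsOrthonormalEigenbasis (U.submatrix e e) (H.submatrix e e) (d ∘ e) where
  mul_transpose_self := by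
    rw [transpose_submatrix, submatrix_mul_equiv, hH.1, submatrix_one_equiv]
  eq_mul_diagonal_mul_transpose := by
    rw [← submatrix_diagonal_equiv, transpose_submatrix, submatrix_mul_equiv, submatrix_mul_equiv,
      ← hH.2]

end Constructions

theorem charpoly_eq {U H : Matrix ι ι R} {d : ι → R} (hH : IsOrthonormalEigenbasis U H d) :
    H.charpoly = ∏ i, (Polynomial.X - Polynomial.C (d i)) := by
  rw [hH.2, charpoly_mul_comm, ← Matrix.mul_assoc, mul_eq_one_comm.1 hH.1, Matrix.one_mul,
    charpoly_diagonal]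

theorem rank_eq [DecidableEq K] {U H : Matrix ι ι K} {d : ι → K}
    (hH : IsOrthonormalEigenbasis U H d) : H.rank = #{i | d i ≠ 0} := by
  have hU : IsUnit U.det := (isUnit_iff_isUnit_det U).1 (IsUnit.of_mul_eq_one _ hH.1)
  rw [hH.2, rank_mul_eq_left_of_isUnit_det _ _ (isUnit_det_transpose _ hU),
    rank_mul_eq_right_of_isUnit_det _ _ hU, rank_diagonal, Fintype.card_subtype]

theorem finrank_eigenspace [DecidableEq K] {U H : Matrix ι ι K} {d : ι → K}
    (hH : IsOrthonormalEigenbasis U H d) (μ : K) :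
    Module.finrank K (Module.End.eigenspace (toLin' H) μ) = #{i | d i = μ} := by
  have hshift : IsOrthonormalEigenbasis U (H + -μ • 1) (d + -μ • 1) :=
    hH.add ((one hH.1).smul _)
  have heigenspace : Module.End.eigenspace (toLin' H) μ = (toLin' (H + -μ • 1)).ker := by
    simp [Module.End.eigenspace_def, sub_eq_add_neg, Module.End.one_eq_id]
  have hrankNullity := (toLin' (H + -μ • 1)).finrank_range_add_finrank_ker
  have hcompl : #{i | (d + -μ • 1) i ≠ 0} + #{i | d i = μ} = Fintype.card ι := by
    have := card_filter_add_card_filter_not (s := univ) (fun i => d i = μ)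
    simpa [← sub_eq_add_neg, sub_eq_zero, add_comm] using this
  rw [← heigenspace, toLin'_apply', ← Matrix.rank, hshift.rank_eq,
    Module.finrank_fintype_fun_eq_card] at hrankNullity
  lia

variable {U H : Matrix ι ι ℝ} {d : ι → ℝ}

theorem equivalent_weightedSumSquares (hH : IsOrthonormalEigenbasis U H d) :
    (toQuadraticForm' H).Equivalent (QuadraticMap.weightedSumSquares ℝ d) := by
  refine ⟨⟨toLin'OfInv hH.1 (mul_eq_one_comm.1 hH.1), fun x => ?_⟩⟩
  change QuadraticMap.weightedSumSquares ℝ d (Uᵀ *ᵥ x) = toLinearMap₂' ℝ H x x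
  rw [toLinearMap₂'_apply', hH.2, ← mulVec_mulVec, ← mulVec_mulVec, dotProduct_mulVec,
    ← mulVec_transpose, QuadraticMap.weightedSumSquares_apply]
  simp only [dotProduct, mulVec_diagonal, smul_eq_mul]
  exact sum_congr rfl fun i _ => mul_left_comm _ _ _

theorem sigPos_eq (hH : IsOrthonormalEigenbasis U H d) :
    sigPos (toQuadraticForm' H) = #{i | 0 < d i} := by
  rw [QuadraticForm.sigPos_of_equiv_weightedSumSquares hH.equivalent_weightedSumSquares,
    ← Set.ncard_coe_finset, coe_filter_univ]

theorem sigNeg_eq (hH : IsOrthonormalEigenbasis U H d) :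
    sigNeg (toQuadraticForm' H) = #{i | d i < 0} := by
  rw [QuadraticForm.sigNeg_of_equiv_weightedSumSquares hH.equivalent_weightedSumSquares,
    ← Set.ncard_coe_finset, coe_filter_univ]

end IsOrthonormalEigenbasis

theorem exists_isOrthonormalEigenbasis_allOnes {n : Type*} [Fintype n] [DecidableEq n] (a : n) :
    ∃ U, IsOrthonormalEigenbasis U (allOnes n ℝ) (Pi.single a (Fintype.card n : ℝ)) := by
  have hcard : (0 : ℝ) < Fintype.card n := Nat.cast_pos.2 (Fintype.card_pos_iff.2 ⟨a⟩)
  let u : EuclideanSpace ℝ n := WithLp.toLp 2 fun _ => (√(Fintype.card n))⁻¹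
  have hu : ‖u‖ = 1 := by
    simp [u, EuclideanSpace.norm_eq, hcard.le, hcard.ne']
  obtain ⟨b, hb⟩ := Orthonormal.exists_orthonormalBasis_extension_of_card_eq (𝕜 := ℝ)
    (E := EuclideanSpace ℝ n) (by simp) (v := fun _ : n => u) (s := {a})
    (by simpa [orthonormal_iff_ite, Set.domRestrict] using hu)
  have hba : b a = u := hb a rfl
  let U := (EuclideanSpace.basisFun n ℝ).toBasis.toMatrix b
  refine ⟨U, ?_, ?_⟩
  · have := (EuclideanSpace.basisFun n ℝ).toMatrix_orthonormalBasis_self_mul_conjTranspose b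
    rwa [conjTranspose_eq_transpose_of_trivial] at this
  · ext i j
    have hU (k : n) : U k a = (√(Fintype.card n))⁻¹ := by
      simp [U, Module.Basis.toMatrix_apply, hba, u]
    rw [mul_apply, Fintype.sum_eq_single a fun k hk => by simp [hk], mul_diagonal, transpose_apply,
      hU, hU, Pi.single_eq_same, mul_right_comm, ← mul_inv, Real.mul_self_sqrt hcard.le,
      inv_mul_cancel₀ hcard.ne', allOnes_apply]

end OrthonormalEigenbasis

section EigenvalueIndex

theorem prod_comp_eq_prod_pow_card_fiber {ι κ M : Type*} [Fintype ι] [Fintype κ] [DecidableEq κ]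
    [CommMonoid M] (idx : ι → κ) (f : κ → M) :
    ∏ i, f (idx i) = ∏ k, f k ^ #{i | idx i = k} := by
  rw [← prod_fiberwise' univ idx f]
  exact prod_congr rfl fun k _ => prod_const _

theorem card_filter_comp_eq_sum_card_fiber {ι κ : Type*} [Fintype ι] [Fintype κ] [DecidableEq κ]
    (idx : ι → κ) (P : κ → Prop) [DecidablePred P] :
    #{i | P (idx i)} = ∑ k, if P k then #{i | idx i = k} else 0 := by
  rw [card_filter, ← sum_fiberwise' univ idx fun k => if P k then 1 else 0]
  simp

variable {α β : Type*} [DecidableEq α] [DecidableEq β]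

/-- The position in `hessianEigenvalue` of the eigenvalue belonging to the pair `p` of eigenvectors
of the all-ones matrices, when `a` and `b` are the indices of the constant eigenvectors. -/
def eigenvalueIndex (a : α) (b : β) (p : α × β) : Fin 4 :=
  if p.1 = a then if p.2 = b then 3 else 1 else if p.2 = b then 2 else 0

/-- The multiplicities of the eigenvalues of the Hessian of `K_{m,n}`. -/
def hessianMultiplicity (m n : ℕ) : Fin 4 → ℕ :=
  ![(m - 1) * (n - 1), n - 1, m - 1, 1]

theorem card_eigenvalueIndex_eq [Fintype α] [Fintype β] (a : α) (b : β) (k : Fin 4) :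
    #{p | eigenvalueIndex a b p = k} =
      hessianMultiplicity (Fintype.card α) (Fintype.card β) k := by
  have hfiber : ({p | eigenvalueIndex a b p = k} : Finset (α × β)) =
      ![univ.erase a ×ˢ univ.erase b, {a} ×ˢ univ.erase b, univ.erase a ×ˢ {b}, {a} ×ˢ {b}] k := by
    ext ⟨x, y⟩
    rw [mem_filter]
    by_cases hx : x = a <;> by_cases hy : y = b <;> fin_cases k <;>
      simp [eigenvalueIndex, hx, hy, eq_comm (a := a) (b := x), eq_comm (a := b) (b := y)]
  rw [hfiber]
  fin_cases k <;> simp [hessianMultiplicity, card_erase_of_mem]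

end EigenvalueIndex

section HessianSpectrum

/-- The eigenvalues of the Hessian of `K_{m,n}`, in the order of `hessianMultiplicity`. -/
noncomputable def hessianEigenvalue (m n : ℕ) : Fin 4 → ℝ :=
  ![-2 * (m : ℝ) ^ ((n : ℤ) - 2) * (n : ℝ) ^ ((m : ℤ) - 2),
    -((m : ℝ) ^ ((n : ℤ) - 2) * (n : ℝ) ^ ((m : ℤ) - 1)),
    -((m : ℝ) ^ ((n : ℤ) - 1) * (n : ℝ) ^ ((m : ℤ) - 2)),
    (m : ℝ) ^ ((n : ℤ) - 2) * (n : ℝ) ^ ((m : ℤ) - 2) * ((m : ℝ) + n - 1) * ((m : ℝ) + n - 2)]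

theorem hessianEigenvalue_three_pos {m n : ℕ} (hm : 1 ≤ m) (hn : 1 ≤ n) (hmn : 3 ≤ m + n) :
    0 < hessianEigenvalue m n 3 := by
  have hmn' : (3 : ℝ) ≤ m + n := by exact_mod_cast hmn
  have h₁ : (0 : ℝ) < m + n - 1 := by linarith
  have h₂ : (0 : ℝ) < m + n - 2 := by linarith
  change 0 < (m : ℝ) ^ ((n : ℤ) - 2) * (n : ℝ) ^ ((m : ℤ) - 2) * (m + n - 1) * (m + n - 2)
  positivity

theorem hessianEigenvalue_neg_of_ne_three {m n : ℕ} (hm : 1 ≤ m) (hn : 1 ≤ n) {k : Fin 4}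
    (hk : k ≠ 3) : hessianEigenvalue m n k < 0 := by
  have hpos (a b : ℤ) : 0 < (m : ℝ) ^ a * (n : ℝ) ^ b := by positivity
  fin_cases k
  · simpa [hessianEigenvalue, mul_assoc] using hpos _ _
  · simpa [hessianEigenvalue] using hpos _ _
  · simpa [hessianEigenvalue] using hpos _ _
  · exact absurd rfl hk

theorem hessianEigenvalue_pos_iff {m n : ℕ} (hm : 1 ≤ m) (hn : 1 ≤ n) (hmn : 3 ≤ m + n)
    {k : Fin 4} : 0 < hessianEigenvalue m n k ↔ k = 3 :=
  ⟨fun h => of_not_not fun hk => h.not_gt (hessianEigenvalue_neg_of_ne_three hm hn hk),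
    fun h => h ▸ hessianEigenvalue_three_pos hm hn hmn⟩

theorem hessianEigenvalue_neg_iff {m n : ℕ} (hm : 1 ≤ m) (hn : 1 ≤ n) (hmn : 3 ≤ m + n)
    {k : Fin 4} : hessianEigenvalue m n k < 0 ↔ k ≠ 3 :=
  ⟨fun h hk => h.not_gt (hk ▸ hessianEigenvalue_three_pos hm hn hmn),
    hessianEigenvalue_neg_of_ne_three hm hn⟩

theorem sum_ite_ne_three_hessianMultiplicity {m n : ℕ} (hm : 1 ≤ m) (hn : 1 ≤ n) :
    (∑ k, if k ≠ 3 then hessianMultiplicity m n k else 0) = m * n - 1 := by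
  obtain ⟨m, rfl⟩ := Nat.exists_eq_add_of_le' hm
  obtain ⟨n, rfl⟩ := Nat.exists_eq_add_of_le' hn
  have hprod : (m + 1) * (n + 1) - 1 = m * n + n + m := Nat.sub_eq_of_eq_add (by ring)
  simp [Fin.sum_univ_four, hessianMultiplicity, hprod]

theorem hessianEigenvalue_eigenvalueIndex {α β : Type*} [DecidableEq α] [DecidableEq β] {m n : ℕ}
    (hm : 1 ≤ m) (hn : 1 ≤ n) (a : α) (b : β) (p : α × β) :
    hessianEigenvalue m n (eigenvalueIndex a b p) =
      (m : ℝ) ^ ((n : ℤ) - 3) * (n : ℝ) ^ ((m : ℤ) - 3) *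
        (-2 * m * n + -m * (m - 2) * (Pi.single b (n : ℝ) : β → ℝ) p.2 +
          -n * (n - 2) * (Pi.single a (m : ℝ) : α → ℝ) p.1 +
          (m + n) * (m + n - 2) *
            ((Pi.single a (m : ℝ) : α → ℝ) p.1 * (Pi.single b (n : ℝ) : β → ℝ) p.2)) := by
  have hsub_two {x : ℝ} (hx : 0 < x) (k : ℤ) : x ^ (k - 2) = x ^ (k - 3) * x := by
    rw [← zpow_add_one₀ hx.ne']
    congr 1
    ring
  have hsub_one {x : ℝ} (hx : 0 < x) (k : ℤ) : x ^ (k - 1) = x ^ (k - 3) * x * x := by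
    rw [← zpow_add_one₀ hx.ne', ← zpow_add_one₀ hx.ne']
    congr 1
    ring
  have hm' : (0 : ℝ) < m := Nat.cast_pos.2 hm
  have hn' : (0 : ℝ) < n := Nat.cast_pos.2 hn
  by_cases ha : p.1 = a <;> by_cases hb : p.2 = b <;>
    simp [hessianEigenvalue, eigenvalueIndex, ha, hb, hsub_one hm', hsub_one hn', hsub_two hm',
      hsub_two hn'] <;>
    ring

theorem exists_isOrthonormalEigenbasis_hessianAtOne {α β : Type*} [Fintype α] [Fintype β]
    [DecidableEq α] [DecidableEq β] [Fintype (completeBipartiteGraph α β).edgeSet]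
    [DecidableEq (completeBipartiteGraph α β).edgeSet] (a : α) (b : β) :
    ∃ U, IsOrthonormalEigenbasis U (hessianAtOne (completeBipartiteGraph α β))
      (hessianEigenvalue (Fintype.card α) (Fintype.card β) ∘ eigenvalueIndex a b ∘
        (completeBipartiteEdgeEquiv α β).symm) := by
  have : Nonempty α := ⟨a⟩
  have : Nonempty β := ⟨b⟩
  obtain ⟨U, hU⟩ := exists_isOrthonormalEigenbasis_allOnes a
  obtain ⟨V, hV⟩ := exists_isOrthonormalEigenbasis_allOnes b
  have hprod := (hU.kronecker_combination hV (-2 * Fintype.card α * Fintype.card β)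
    (-Fintype.card α * (Fintype.card α - 2)) (-Fintype.card β * (Fintype.card β - 2))
    ((Fintype.card α + Fintype.card β) * (Fintype.card α + Fintype.card β - 2))).smul
    ((Fintype.card α : ℝ) ^ ((Fintype.card β : ℤ) - 3) *
      (Fintype.card β : ℝ) ^ ((Fintype.card α : ℤ) - 3))
  rw [← submatrix_hessianAtOne_completeBipartiteGraph] at hprod
  refine ⟨(U ⊗ₖ V).submatrix (completeBipartiteEdgeEquiv α β).symm
    (completeBipartiteEdgeEquiv α β).symm, ?_⟩
  convert hprod.submatrix_equiv (completeBipartiteEdgeEquiv α β).symm using 1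
  · simp
  · ext e
    exact hessianEigenvalue_eigenvalueIndex Fintype.card_pos Fintype.card_pos a b _

theorem card_filter_eigenvalueIndex {α β : Type*} [Fintype α] [Fintype β]
    [DecidableEq α] [DecidableEq β] [Fintype (completeBipartiteGraph α β).edgeSet] (a : α) (b : β)
    (k : Fin 4) :
    #{i | eigenvalueIndex a b ((completeBipartiteEdgeEquiv α β).symm i) = k} =
      hessianMultiplicity (Fintype.card α) (Fintype.card β) k := by
  rw [← card_eigenvalueIndex_eq a b]
  exact card_equiv (completeBipartiteEdgeEquiv α β).symm (by simp)

end HessianSpectrum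

end SpanningTreeHessian

open SpanningTreeHessian in
theorem mainTheorem3_general {α β : Type*} [Fintype α] [Fintype β] [DecidableEq α] [DecidableEq β]
    {m n : ℕ} (hα : Fintype.card α = m) (hβ : Fintype.card β = n) (hm : 1 ≤ m) (hn : 1 ≤ n)
    (hmn : 3 ≤ m + n) :
    (hessianAtOne (completeBipartiteGraph α β)).charpoly =
      ∏ k, (Polynomial.X - Polynomial.C (hessianEigenvalue m n k)) ^ hessianMultiplicity m n k ∧
    (∀ μ : ℝ, Module.finrank ℝ (Module.End.eigenspace
        (Matrix.toLin' (hessianAtOne (completeBipartiteGraph α β))) μ) =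
      ∑ k, if hessianEigenvalue m n k = μ then hessianMultiplicity m n k else 0) ∧
    sigPos (Matrix.toQuadraticForm' (hessianAtOne (completeBipartiteGraph α β))) = 1 ∧
    sigNeg (Matrix.toQuadraticForm' (hessianAtOne (completeBipartiteGraph α β))) = m * n - 1 := by
  subst hα hβ
  obtain ⟨a⟩ := Fintype.card_pos_iff.1 hm
  obtain ⟨b⟩ := Fintype.card_pos_iff.1 hn
  obtain ⟨U, hU⟩ := exists_isOrthonormalEigenbasis_hessianAtOne a b
  have hcount (P : ℝ → Prop) [DecidablePred P] := card_filter_comp_eq_sum_card_fiber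
    (eigenvalueIndex a b ∘ (completeBipartiteEdgeEquiv α β).symm)
    fun k => P (hessianEigenvalue (Fintype.card α) (Fintype.card β) k)
  simp only [Function.comp_apply, card_filter_eigenvalueIndex] at hcount
  refine ⟨?_, fun μ => ?_, ?_, ?_⟩
  · rw [hU.charpoly_eq]
    refine (prod_comp_eq_prod_pow_card_fiber
      (eigenvalueIndex a b ∘ (completeBipartiteEdgeEquiv α β).symm) fun k => Polynomial.X -
        Polynomial.C (hessianEigenvalue (Fintype.card α) (Fintype.card β) k)).trans ?_
    simp only [Function.comp_apply, card_filter_eigenvalueIndex]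
  · rw [hU.finrank_eigenspace]
    exact hcount (· = μ)
  · rw [hU.sigPos_eq]
    refine (hcount (0 < ·)).trans ?_
    simp [hessianEigenvalue_pos_iff hm hn hmn, hessianMultiplicity]
  · rw [hU.sigNeg_eq]
    refine (hcount (· < 0)).trans ?_
    simp only [hessianEigenvalue_neg_iff hm hn hmn]
    exact sum_ite_ne_three_hessianMultiplicity hm hn

theorem mainTheorem3 (m n : ℕ) (hm : 1 ≤ m) (hn : 1 ≤ n) (hmn : 3 ≤ m + n)
    (H : Matrix (completeBipartiteGraph (Fin m) (Fin n)).edgeSet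
        (completeBipartiteGraph (Fin m) (Fin n)).edgeSet ℝ)
    (hH : H = SpanningTreeHessian.hessianAtOne (completeBipartiteGraph (Fin m) (Fin n)))
    -- the four eigenvalues
    (ev : Fin 4 → ℝ)
    (hev : ev =
      ![-2 * (m : ℝ) ^ ((n : ℤ) - 2) * (n : ℝ) ^ ((m : ℤ) - 2),
        -((m : ℝ) ^ ((n : ℤ) - 2) * (n : ℝ) ^ ((m : ℤ) - 1)),
        -((m : ℝ) ^ ((n : ℤ) - 1) * (n : ℝ) ^ ((m : ℤ) - 2)),
        (m : ℝ) ^ ((n : ℤ) - 2) * (n : ℝ) ^ ((m : ℤ) - 2) *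
          ((m : ℝ) + n - 1) * ((m : ℝ) + n - 2)])
    -- their multiplicities
    (mult : Fin 4 → ℕ)
    (hmult : mult = ![(m - 1) * (n - 1), n - 1, m - 1, 1]) :
    -- algebraic multiplicities
    H.charpoly = ∏ k, (Polynomial.X - Polynomial.C (ev k)) ^ mult k ∧
    -- dimensions of the eigenspaces; the contributions of coinciding eigenvalues add up
    (∀ μ : ℝ, Module.finrank ℝ (Module.End.eigenspace (Matrix.toLin' H) μ) =
      ∑ k, if ev k = μ then mult k else 0) ∧
    -- Lorentzian signature
    sigPos (Matrix.toQuadraticForm' H) = 1 ∧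
    sigNeg (Matrix.toQuadraticForm' H) = m * n - 1 := by
  subst hH hev hmult
  exact mainTheorem3_general (Fintype.card_fin m) (Fintype.card_fin n) hm hn hmn
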